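/- Let $2\le k\le m$ be integers, $S=\{1,\dots,m\}$, $n=\binom{m-1}{k-1}$, and let $C:S\to\{0,1\}^n$ be a systematic code, i.e. distinct codewords have normalized Hamming distance at least $\frac13$, and the projection of $C$ to the first $\lceil\log_2 m\rceil$ bits is one-to-one. *The property.* A string $x\in\{0,1\}^{2n}$ has key $\kappa(x)=a\in S$ if its first $\lceil\log_2 m\rceil$ bits are those of $C(a)$, and its key is valid if moreover its first $n$ bits are $C(a)$. For each $a\in S$ fix a bijection between the last $n$ positions and the $(k-1)$-element subsets of $S\setminus\{a\}$. If $\kappa(x)=a\in A\subseteq S$ and $|A|=k$, let $\Phi_x(A)$ be the bit of $x$ at the position that corresponds to $A\setminus\{a\}$. $\mathbf{Par}_k$ is the set of the distributions $P$ over $\{0,1\}^{2n}$ such that every string in the support of $P$ has a valid key and, for all $a_1<\dots<a_k$ in $S$ and $A=\{a_1,\dots,a_k\}$, $$\Pr_{x^1,\dots,x^k\sim P}\Big[\kappa(x^i)=a_i\text{ for all }i,\text{ and }\textstyle\bigoplus_{i=1}^k\Phi_{x^i}(A)=1\Big]=0$$ for independent samples $x^1,\dots,x^k$. *The model.* A deterministic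 strong $k'$-memory algorithm with $s$ samples and $q$ queries is a full binary decision tree of height $q$ with a set of accepted leaves. Each internal node queries a bit $j$ of a sample $i\in\{1,\dots,s\}$, and each node $u$ has a memory state $M(u)\subseteq\{1,\dots,s\}$ such that, at every internal node $u$: $|M(u)|\le k'$; the sample queried at $u$ is in $M(u)$; and if $i\in M(u)$ but $i\notin M(v)$ for a child $v$ of $u$, then $i\notin M(w)$ for every descendant $w$ of $v$. A strong $k'$-memory algorithm with $s$ samples and $q$ queries is a probability distribution over such deterministic algorithms. It is run on $s$ independent samples from an unknown input distribution over $\{0,1\}^{2n}$. It is an $\varepsilon$-test for $\mathbf{Par}_k$ if it accepts every $P\in\mathbf{Par}_k$ with probability greater than $\frac23$, and accepts with probability less than $\frac13$ every $P$ whose earth mover's distance (with respect to the normalized Hamming distance) from $\mathbf{Par}_k$, $\inf_{Q\in\mathbf{Par}_k}d_{\mathrm{EMD}}(P,Q)$, is more than $\varepsilon$. **Theorem.** Every strong $(k-1)$-memory $\frac1{6k}$-test for $\mathbf{Par}_k$, with any number of samples, must use at least $\frac12\sqrt m$ queries. -/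

import Mathlib

open scoped ENNReal

/-! ### Strings, distributions and distances -/

/-- Binary strings of length `N`. -/
abbrev BStr (N : ℕ) : Type := Fin N → Bool

/-- Normalized Hamming distance between two strings. -/
noncomputable def normHamming {N : ℕ} (x y : BStr N) : ℝ≥0∞ :=
  (hammingDist x y : ℝ≥0∞) / (N : ℝ≥0∞)

/-- The transfer distributions (couplings) between `P` and `Q`. -/
def transfers {Ω : Type} (P Q : PMF Ω) : Set (PMF (Ω × Ω)) :=
  {T | T.map Prod.fst = P ∧ T.map Prod.snd = Q}

/-- Earth mover's distance with respect to the normalized Hamming distance. -/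
noncomputable def emd {N : ℕ} (P Q : PMF (BStr N)) : ℝ≥0∞ :=
  ⨅ T ∈ transfers P Q, ∑ z : BStr N × BStr N, T z * normHamming z.1 z.2

/-- Distance of a distribution from a set of distributions. -/
noncomputable def distToProp {N : ℕ} (P : PMF (BStr N)) (Prop' : Set (PMF (BStr N))) : ℝ≥0∞ :=
  ⨅ Q ∈ Prop', emd P Q

/-- `P` is `ε`-far from the property: its distance from it is more than `ε`. -/
def IsFar {N : ℕ} (ε : ℝ) (P : PMF (BStr N)) (Prop' : Set (PMF (BStr N))) : Prop :=
  ENNReal.ofReal ε < distToProp P Prop'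

open Classical in
/-- The probability of the event `E` for `s` independent samples drawn from `P`. -/
noncomputable def iidProb {N : ℕ} (P : PMF (BStr N)) (s : ℕ) (E : (Fin s → BStr N) → Prop) :
    ℝ≥0∞ :=
  ∑ X : Fin s → BStr N, if E X then ∏ i, P (X i) else 0

/-! ### Strong memory-bounded adaptive algorithms -/

/-- Full binary decision trees of height `q` which query bits of `s` samples of length `N`.
Every node `u` carries a memory state `M(u)`, every internal node a query `(i, j)` (bit `j` of
sample `i`) and a child for each answer, and every leaf tells whether it is accepted. -/
inductive MemTree (s N : ℕ) : ℕ → Type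
  | leaf (mem : Finset (Fin s)) (accept : Bool) : MemTree s N 0
  | node {q : ℕ} (mem : Finset (Fin s)) (i : Fin s) (j : Fin N)
      (child : Bool → MemTree s N q) : MemTree s N (q + 1)

namespace MemTree

/-- The memory state at the root. -/
def rootMem {s N : ℕ} : {q : ℕ} → MemTree s N q → Finset (Fin s)
  | _, leaf mem _ => mem
  | _, node mem _ _ _ => mem

/-- Sample `i` is not in memory at the root, nor at any of its descendants. -/
def NeverHolds {s N : ℕ} (i : Fin s) : {q : ℕ} → MemTree s N q → Prop
  | _, leaf mem _ => i ∉ mem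
  | _, node mem _ _ child => i ∉ mem ∧ ∀ b, NeverHolds i (child b)

/-- The rules of a strong `k`-memory algorithm. At every internal node, at most `k` samples are
in memory, the queried sample is in memory, and a sample that is in memory there but not at a
child is not in memory at any descendant of that child. -/
def IsStrong {s N : ℕ} (k : ℕ) : {q : ℕ} → MemTree s N q → Prop
  | _, leaf _ _ => True
  | _, node mem i _ child =>
      mem.card ≤ k ∧ i ∈ mem ∧
      (∀ b, ∀ i' ∈ mem, i' ∉ (child b).rootMem → (child b).NeverHolds i') ∧
      ∀ b, IsStrong k (child b)

/-- The outcome of the execution on the sample matrix `X`. -/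
def run {s N : ℕ} (X : Fin s → BStr N) : {q : ℕ} → MemTree s N q → Bool
  | _, leaf _ accept => accept
  | _, node _ i j child => run X (child (X i j))

end MemTree

/-- Probabilistic strong `k`-memory algorithms for `s` samples of length `N` with `q` queries:
distributions over the deterministic ones. -/
abbrev StrongMemAlg (k s N q : ℕ) : Type := PMF {T : MemTree s N q // T.IsStrong k}

/-- The probability that the algorithm accepts the input distribution `P`. -/
noncomputable def acceptProb {k s N q : ℕ} (𝒜 : StrongMemAlg k s N q) (P : PMF (BStr N)) :
    ℝ≥0∞ :=
  ∑' T, 𝒜 T * iidProb P s (fun X => T.1.run X = true)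

/-- The algorithm is an `ε`-test (with two-sided error) for the property. -/
def IsTest {k s N q : ℕ} (ε : ℝ) (𝒜 : StrongMemAlg k s N q) (Prop' : Set (PMF (BStr N))) :
    Prop :=
  (∀ P ∈ Prop', 2 / 3 < acceptProb 𝒜 P) ∧
  ∀ P, IsFar ε P Prop' → acceptProb 𝒜 P < 1 / 3

/-! ### The parity property -/

/-- Systematic codes: the normalized distance between different codewords is at least `1/3`,
and the projection on the first `⌈log₂ m⌉` bits is one-to-one. -/
structure IsSystematicCode {m n : ℕ} (C : Fin m → BStr n) : Prop where
  minDist : ∀ a b, a ≠ b → 1 / 3 ≤ normHamming (C a) (C b)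
  prefixInj : ∀ a b, (∀ j : Fin n, (j : ℕ) < Nat.clog 2 m → C a j = C b j) → a = b

/-- The number `n = binom (m-1) (k-1)`; the strings have length `2n`. -/
abbrev parLen (k m : ℕ) : ℕ := (m - 1).choose (k - 1)

/-- The subsets of `S \ {a}` of size `k - 1`, where `S = Fin m`. -/
abbrev CoSet (k m : ℕ) (a : Fin m) : Type :=
  {B : Finset (Fin m) // a ∉ B ∧ B.card = k - 1}

/-- The key part: the first `n` bits. -/
def keyPart {n : ℕ} (x : BStr (2 * n)) : BStr n := fun j => x ⟨j, by omega⟩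

/-- The data part: the last `n` bits. -/
def dataPart {n : ℕ} (x : BStr (2 * n)) : BStr n := fun j => x ⟨n + j, by omega⟩

/-- `κ(x) = a`: the first `⌈log₂ m⌉` bits of `x` are those of the codeword of `a`. -/
def HasKey {m n : ℕ} (C : Fin m → BStr n) (x : BStr (2 * n)) (a : Fin m) : Prop :=
  ∀ j : Fin n, (j : ℕ) < Nat.clog 2 m → keyPart x j = C a j

/-- `x` has a valid key: its key part is the codeword of its key. -/
def HasValidKey {m n : ℕ} (C : Fin m → BStr n) (x : BStr (2 * n)) : Prop :=
  ∃ a, HasKey C x a ∧ keyPart x = C a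

/-- For `A = {a₁ < ⋯ < a_k}`, the set `A \ {aᵢ}`. -/
def coSet {k m : ℕ} (a : Fin k ↪o Fin m) (i : Fin k) : CoSet k m (a i) :=
  ⟨(Finset.univ.map a.toEmbedding).erase (a i), Finset.notMem_erase _ _, by
    rw [Finset.card_erase_of_mem (by simp), Finset.card_map, Finset.card_univ, Fintype.card_fin]⟩

/-- `P` is parity-valid at `A = {a₁ < ⋯ < a_k}`: with probability zero, `k` independent samples
have the keys `a₁, …, a_k` and the bits `Φ_{xⁱ}(A) = φ_{xⁱ}(A \ {aᵢ})` have odd parity. Here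
`enc a` tells which data bit of a string with key `a` belongs to which subset of `S \ {a}`. -/
def ParityValidAt {k m : ℕ} (C : Fin m → BStr (parLen k m))
    (enc : ∀ a : Fin m, CoSet k m a ≃ Fin (parLen k m))
    (P : PMF (BStr (2 * parLen k m))) (a : Fin k ↪o Fin m) : Prop :=
  iidProb P k (fun X => (∀ i, HasKey C (X i) (a i)) ∧
    Odd (Finset.univ.filter fun i : Fin k =>
      dataPart (X i) (enc (a i) (coSet a i)) = true).card) = 0

/-- The property `Par_k` for the size parameter `m`: all parity-valid distributions over strings
of length `2n` with valid keys. -/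
def Par {k m : ℕ} (C : Fin m → BStr (parLen k m))
    (enc : ∀ a : Fin m, CoSet k m a ≃ Fin (parLen k m)) : Set (PMF (BStr (2 * parLen k m))) :=
  {P | (∀ x ∈ P.support, HasValidKey C x) ∧ ∀ a : Fin k ↪o Fin m, ParityValidAt C enc P a}

/-! Give every k-set A and every a in A one bit. An assignment of such bits defines m strings, one
per key, and the uniform distribution on them. If all k-sets have even parity it lies in the
property; if all have odd parity it is far from it. The two cases are compared on average over all
assignments.

Indistinguishability: samples amount to uniform independent keys. Call the first query to a sample a
surprise if its key was seen before, or completes the seen keys to a set A one of whose bits was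
already queried. After h queries at most 2h keys are surprising, so a surprise occurs with
probability at most q²/m. Without one, no set A is fully read: when its last key appears, k samples
are involved but only k-1 fit in memory, so some other sample has been dropped for good, its bit of
A was read earlier, and the new key is a surprise. If every A keeps an unread bit, flipping one such
bit per set turns even parities into odd ones without changing the execution.

Distance: let Q have the property. For every A some a in A is such that all strings of Q with key a
disagree with the odd assignment at A; otherwise Q would show an odd tuple with positive
probability. Moving the string of a into Q costs these disagreements, or about n/3 bits if the key
changes. Double counting gives more than 1/(6k) on average. -/

namespace MemTree

/-! ### Executions, surprises, and sets that are not completely queried -/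

variable {s N m : ℕ}

/-- The bits that are queried in the execution on the sample matrix `X`. -/
def queried (X : Fin s → BStr N) : {q : ℕ} → MemTree s N q → Finset (Fin s × Fin N)
  | _, leaf _ _ => ∅
  | _, node _ i j child => insert (i, j) (queried X (child (X i j)))

theorem run_congr {X Y : Fin s → BStr N} {q : ℕ} (T : MemTree s N q)
    (h : ∀ p ∈ T.queried X, X p.1 p.2 = Y p.1 p.2) :
    T.run X = T.run Y ∧ T.queried X = T.queried Y := by
  induction T with
  | leaf mem acc => simp [run, queried]
  | node mem i j child ih =>
    have h0 : X i j = Y i j := h (i, j) (by simp [queried])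
    have := ih (X i j) fun p hp => h p (by simp [queried, hp])
    simp only [run, queried]
    rw [← h0]
    exact ⟨this.1, by rw [this.2]⟩

theorem notMem_queried_of_neverHolds {X : Fin s → BStr N} {k q : ℕ} {T : MemTree s N q}
    (hT : T.IsStrong k) {i : Fin s} (hi : T.NeverHolds i) (j : Fin N) :
    (i, j) ∉ T.queried X := by
  induction T with
  | leaf mem acc => simp [queried]
  | node mem i' j' child ih =>
    simp only [IsStrong, NeverHolds] at hT hi
    simp only [queried, Finset.mem_insert, Prod.mk.injEq, not_or, not_and]
    exact ⟨fun h => absurd hT.2.1 (h ▸ hi.1), ih _ (hT.2.2.2 _) (hi.2 _)⟩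

/-- In the execution on the strings with the keys `κ`, started with the history `H` of queries,
some sample that is queried for the first time has a key in the set `F` of the history. -/
def Hits (x : Fin m → BStr N) (F : Finset (Fin s × Fin N) → (Fin s → Fin m) → Finset (Fin m))
    (κ : Fin s → Fin m) : {q : ℕ} → Finset (Fin s × Fin N) → MemTree s N q → Prop
  | _, _, leaf _ _ => False
  | _, H, node _ i j child => (i ∉ H.image Prod.fst ∧ κ i ∈ F H κ) ∨
      Hits x F κ (insert (i, j) H) (child (x (κ i) j))

/-- The maps that agree with `κ₀` on `R`. -/
def extensions (R : Finset (Fin s)) (κ₀ : Fin s → Fin m) : Finset (Fin s → Fin m) :=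
  Finset.univ.filter fun κ => ∀ i ∈ R, κ i = κ₀ i

theorem mem_extensions {R : Finset (Fin s)} {κ₀ κ : Fin s → Fin m} :
    κ ∈ extensions R κ₀ ↔ ∀ i ∈ R, κ i = κ₀ i := by simp [extensions]

theorem card_extensions (R : Finset (Fin s)) (κ₀ : Fin s → Fin m) :
    (extensions R κ₀).card = m ^ Rᶜ.card := by
  have : extensions R κ₀ = Fintype.piFinset fun i => if i ∈ R then {κ₀ i} else Finset.univ := by
    ext κ
    simp only [mem_extensions, Fintype.mem_piFinset]
    refine forall_congr' fun i => ?_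
    split_ifs with h <;> simp [h]
  rw [this, Fintype.card_piFinset, Finset.card_eq_sum_ones, ← Finset.prod_pow_eq_pow_sum,
    ← Finset.prod_subset (Finset.subset_univ Rᶜ)]
  · refine Finset.prod_congr rfl fun i hi => ?_
    simp [Finset.mem_compl.1 hi]
  · intro i _ hi
    simp [not_not.1 fun h => hi (Finset.mem_compl.2 h)]

theorem card_extensions_insert {R : Finset (Fin s)} {i : Fin s} (hi : i ∉ R)
    (κ₀ κ₁ : Fin s → Fin m) :
    m * (extensions (insert i R) κ₁).card = (extensions R κ₀).card := by
  rw [card_extensions, card_extensions, Finset.compl_insert, ← pow_succ',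
    Finset.card_erase_add_one (Finset.mem_compl.2 hi)]

open Classical in
theorem card_filter_extensions {R : Finset (Fin s)} {i : Fin s} (hi : i ∉ R)
    (κ₀ : Fin s → Fin m) (E : (Fin s → Fin m) → Prop) :
    ((extensions R κ₀).filter E).card =
      ∑ a, ((extensions (insert i R) (Function.update κ₀ i a)).filter E).card := by
  rw [Finset.card_eq_sum_card_fiberwise (f := fun κ => κ i) (t := Finset.univ) (by simp)]
  refine Finset.sum_congr rfl fun a _ => congrArg _ ?_
  ext κ
  simp only [Finset.mem_filter, mem_extensions, Finset.forall_mem_insert, Function.update_self]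
  constructor
  · rintro ⟨⟨h, hE⟩, ha⟩
    refine ⟨⟨ha, fun j hj => ?_⟩, hE⟩
    rw [Function.update_of_ne (ne_of_mem_of_not_mem hj hi), h j hj]
  · rintro ⟨⟨ha, h⟩, hE⟩
    refine ⟨⟨fun j hj => ?_, hE⟩, ha⟩
    rw [h j hj, Function.update_of_ne (ne_of_mem_of_not_mem hj hi)]

-- A union bound over first queries. Conditioned on the keys of the samples queried so far, the key
-- of a new sample is uniform, and `F` is fixed by the conditioning, so the t-th further query hits
-- with probability at most 2(h+t)/m. The classes `extensions` express this conditioning by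
-- counting.
open Classical in
theorem card_hits_le (x : Fin m → BStr N)
    (F : Finset (Fin s × Fin N) → (Fin s → Fin m) → Finset (Fin m))
    (hF : ∀ H κ κ', (∀ i ∈ H.image Prod.fst, κ i = κ' i) → F H κ = F H κ')
    (hcard : ∀ H κ, (F H κ).card ≤ 2 * H.card) {q : ℕ} (T : MemTree s N q)
    (H : Finset (Fin s × Fin N)) (κ₀ : Fin s → Fin m) (h : ℕ) (hH : H.card ≤ h) :
    m * ((extensions (H.image Prod.fst) κ₀).filter fun κ => Hits x F κ H T).card ≤
      (∑ t ∈ Finset.range q, 2 * (h + t)) * (extensions (H.image Prod.fst) κ₀).card := by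
  induction T generalizing H κ₀ h with
  | leaf mem acc =>
    rw [Finset.filter_eq_empty_iff.2 (by simp [Hits])]
    simp
  | @node q mem i j child ih =>
    have hsum : ∑ t ∈ Finset.range (q + 1), 2 * (h + t) =
        2 * h + ∑ t ∈ Finset.range q, 2 * (h + 1 + t) := by
      rw [Finset.sum_range_succ', add_comm]
      congr 1
      exact Finset.sum_congr rfl fun t _ => by ring
    have hH' : (insert (i, j) H).card ≤ h + 1 := (Finset.card_insert_le _ _).trans (by omega)
    have himg : (insert (i, j) H).image Prod.fst = insert i (H.image Prod.fst) := by
      rw [Finset.image_insert]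
    by_cases hi : i ∈ H.image Prod.fst
    · have key := ih (x (κ₀ i) j) (insert (i, j) H) κ₀ (h + 1) hH'
      rw [himg, Finset.insert_eq_of_mem hi] at key
      refine (le_of_eq ?_).trans (key.trans ?_)
      · congr 2
        refine Finset.filter_congr fun κ hκ => ?_
        simp [Hits, hi, mem_extensions.1 hκ i hi]
      · rw [hsum]
        exact Nat.mul_le_mul_right _ (Nat.le_add_left _ _)
    · set R := H.image Prod.fst with hR
      set n := (extensions R κ₀).card
      set b := ∑ t ∈ Finset.range q, 2 * (h + 1 + t)
      -- Split by the key a of the new sample: for a in `F` the whole subclass is given up,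
      -- otherwise there is no hit yet and induction applies.
      have hclass : ∀ a, m * ((extensions (insert i R) (Function.update κ₀ i a)).filter
          fun κ => Hits x F κ H (node mem i j child)).card ≤
          (if a ∈ F H κ₀ then n else 0) +
            b * (extensions (insert i R) (Function.update κ₀ i a)).card := by
        intro a
        have hF' : ∀ κ ∈ extensions (insert i R) (Function.update κ₀ i a),
            F H κ = F H κ₀ ∧ κ i = a := by
          intro κ hκ
          rw [mem_extensions, Finset.forall_mem_insert, Function.update_self] at hκ
          refine ⟨hF _ _ _ fun j hj => ?_, hκ.1⟩
          rw [hκ.2 j hj, Function.update_of_ne (ne_of_mem_of_not_mem hj hi)]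
        split_ifs with ha
        · refine le_add_right ?_
          refine le_of_le_of_eq ?_ (card_extensions_insert hi κ₀ (Function.update κ₀ i a))
          exact Nat.mul_le_mul_left _ (Finset.card_filter_le _ _)
        · rw [zero_add]
          have key := ih (x a j) (insert (i, j) H) (Function.update κ₀ i a) (h + 1) hH'
          rw [himg] at key
          refine (le_of_eq ?_).trans key
          congr 2
          refine Finset.filter_congr fun κ hκ => ?_
          obtain ⟨h1, h2⟩ := hF' κ hκ
          simp [Hits, h1, h2, ha]
      rw [card_filter_extensions hi, Finset.mul_sum]
      refine (Finset.sum_le_sum fun a _ => hclass a).trans ?_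
      rw [Finset.sum_add_distrib, ← Finset.mul_sum, hsum, add_mul]
      refine add_le_add ?_ (Nat.mul_le_mul_left _ (le_of_eq ?_))
      · rw [← Finset.sum_filter, Finset.sum_const, smul_eq_mul]
        refine Nat.mul_le_mul_right _ (le_trans ?_ ((hcard H κ₀).trans (by omega)))
        exact Finset.card_le_card (by intro; simp)
      · have := card_filter_extensions hi κ₀ fun _ => True
        simpa using this.symm

/-- The keys of a new sample that would be a surprise after the history `H`: the keys that were
seen before, and those that complete the keys seen to a set that was queried before. Here
`qset a j` is the set to which bit `j` of a string with key `a` belongs. -/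
def surprises (qset : Fin m → Fin N → Finset (Fin m)) (H : Finset (Fin s × Fin N))
    (κ : Fin s → Fin m) : Finset (Fin m) :=
  (H.image Prod.fst).image κ ∪ H.biUnion fun p => Finset.univ.filter fun b =>
    qset (κ p.1) p.2 \ (H.image Prod.fst).image κ = {b}

theorem surprises_congr (qset : Fin m → Fin N → Finset (Fin m)) (H : Finset (Fin s × Fin N))
    (κ κ' : Fin s → Fin m) (h : ∀ i ∈ H.image Prod.fst, κ i = κ' i) :
    surprises qset H κ = surprises qset H κ' := by
  unfold surprises
  have : (H.image Prod.fst).image κ = (H.image Prod.fst).image κ' := Finset.image_congr h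
  rw [this]
  congr 1
  refine Finset.biUnion_congr rfl fun p hp => ?_
  rw [h p.1 (Finset.mem_image_of_mem _ hp)]

theorem card_surprises_le (qset : Fin m → Fin N → Finset (Fin m)) (H : Finset (Fin s × Fin N))
    (κ : Fin s → Fin m) : (surprises qset H κ).card ≤ 2 * H.card := by
  refine (Finset.card_union_le _ _).trans ?_
  have h1 : ((H.image Prod.fst).image κ).card ≤ H.card :=
    Finset.card_image_le.trans Finset.card_image_le
  have h2 := Finset.card_biUnion_le_card_mul H (fun p => Finset.univ.filter fun b =>
    qset (κ p.1) p.2 \ (H.image Prod.fst).image κ = {b}) 1 (fun p _ => by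
      refine Finset.card_le_one.2 fun a ha b hb => ?_
      simp only [Finset.mem_filter] at ha hb
      exact Finset.singleton_injective (ha.2.symm.trans hb.2))
  omega

/-- A new sample that repeats a seen key is a surprise at its first query, so without surprises a
seen key is only ever read from samples of the history. -/
theorem mem_history_of_not_hits {x : Fin m → BStr N} {qset : Fin m → Fin N → Finset (Fin m)}
    {κ : Fin s → Fin m} {q : ℕ} {T : MemTree s N q} {H : Finset (Fin s × Fin N)}
    (hT : ¬ T.Hits x (surprises qset) κ H) {p : Fin s × Fin N}
    (hp : p ∈ T.queried fun i => x (κ i)) (hκ : κ p.1 ∈ (H.image Prod.fst).image κ) :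
    p.1 ∈ H.image Prod.fst := by
  induction T generalizing H with
  | leaf mem acc => simp [queried] at hp
  | node mem i j child ih =>
    simp only [Hits, not_or, not_and] at hT
    simp only [queried, Finset.mem_insert] at hp
    by_contra hpH
    rcases hp with rfl | hp
    · exact hT.1 hpH (Finset.mem_union_left _ hκ)
    · have := ih _ hT.2 hp (by
        rw [Finset.image_insert, Finset.image_insert]; exact Finset.mem_insert_of_mem hκ)
      rw [Finset.image_insert, Finset.mem_insert] at this
      rcases this with h | h
      · rw [h] at hpH hκ
        exact hT.1 hpH (Finset.mem_union_left _ hκ)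
      · exact hpH h

/-- Without surprises, a strong `(k - 1)`-memory algorithm does not query all the bits that
belong to a set of `k` keys. -/
theorem subset_of_not_hits {x : Fin m → BStr N} {qset : Fin m → Fin N → Finset (Fin m)}
    {κ : Fin s → Fin m} {k q : ℕ} (hk : 1 ≤ k) {T : MemTree s N q} {H : Finset (Fin s × Fin N)}
    (hT : ¬ T.Hits x (surprises qset) κ H) (hs : T.IsStrong (k - 1))
    (hH : ∀ i ∈ H.image Prod.fst, i ∈ T.rootMem ∨ T.NeverHolds i)
    {A : Finset (Fin m)} (hA : A.card = k)
    (hq : ∀ a ∈ A, ∃ p ∈ H ∪ T.queried fun i => x (κ i), κ p.1 = a ∧ qset a p.2 = A) :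
    A ⊆ (H.image Prod.fst).image κ := by
  induction T generalizing H with
  | leaf mem acc =>
    intro a ha
    obtain ⟨p, hp, hpa, -⟩ := hq a ha
    simp only [queried, Finset.union_empty] at hp
    exact hpa ▸ Finset.mem_image_of_mem _ (Finset.mem_image_of_mem _ hp)
  | node mem i j child ih =>
    have hTn := hT
    have hsn := hs
    simp only [Hits, not_or, not_and] at hT
    simp only [IsStrong] at hs
    have himg : (insert (i, j) H).image Prod.fst = insert i (H.image Prod.fst) := by
      rw [Finset.image_insert]
    have hsub := ih (x (κ i) j) hT.2 (hs.2.2.2 _) (by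
      intro i' hi'
      have hi'' : i' ∈ mem ∨ NeverHolds i' (node mem i j child) := by
        rw [himg, Finset.mem_insert] at hi'
        rcases hi' with rfl | hi'
        · exact Or.inl hs.2.1
        · exact hH i' hi'
      rcases hi'' with h | h
      · by_cases hc : i' ∈ (child (x (κ i) j)).rootMem
        · exact Or.inl hc
        · exact Or.inr (hs.2.2.1 _ _ h hc)
      · exact Or.inr (h.2 _)) (by
      intro a ha
      obtain ⟨p, hp, h⟩ := hq a ha
      refine ⟨p, ?_, h⟩
      simp only [queried, Finset.mem_union, Finset.mem_insert] at hp ⊢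
      tauto)
    rw [himg, Finset.image_insert] at hsub
    -- In this case the current query is the one that reveals the last key of `A`.
    by_contra hnot
    set K := (H.image Prod.fst).image κ with hK
    have hbA : κ i ∈ A := by
      by_contra hb
      exact hnot fun a ha => (Finset.mem_insert.1 (hsub ha)).resolve_left fun h => hb (h ▸ ha)
    have hbK : κ i ∉ K := fun hb => hnot fun a ha => by
      rcases Finset.mem_insert.1 (hsub ha) with rfl | h
      exacts [hb, h]
    have hiH : i ∉ H.image Prod.fst := fun h => hbK (Finset.mem_image_of_mem _ h)
    have : Nonempty (Fin s × Fin N) := ⟨(i, j)⟩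
    choose! p hp hpκ hpA using hq
    have hAK : ∀ a ∈ A, a ≠ κ i → a ∈ K := fun a ha hne =>
      (Finset.mem_insert.1 (hsub ha)).resolve_left hne
    have hpH : ∀ a ∈ A, a ≠ κ i → (p a).1 ∈ H.image Prod.fst := by
      intro a ha hne
      rcases Finset.mem_union.1 (hp a ha) with h | h
      · exact Finset.mem_image_of_mem _ h
      · exact mem_history_of_not_hits hTn h (by rw [hpκ a ha]; exact hAK a ha hne)
    -- Pigeonhole: the k keys of `A` belong to k different samples, and memory holds at most k-1.
    obtain ⟨a, ha, hamem⟩ : ∃ a ∈ A, (if a = κ i then i else (p a).1) ∉ mem := by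
      by_contra! hall
      have := Finset.card_le_card_of_injOn (fun a => if a = κ i then i else (p a).1)
        (s := A) (t := mem) hall (by
          intro a ha b hb hab
          have hκ : ∀ c ∈ A, κ (if c = κ i then i else (p c).1) = c := by
            intro c hc
            split_ifs with h
            exacts [h.symm, hpκ c hc]
          rw [← hκ a ha, ← hκ b hb]
          exact congrArg κ hab)
      have := hs.1
      omega
    have hne : a ≠ κ i := by
      rintro rfl
      simp only [if_true] at hamem
      exact hamem hs.2.1
    rw [if_neg hne] at hamem
    -- The sample has been seen but is not in memory, so it never returns and its bit of `A` was
    -- read earlier.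
    have hpa : p a ∈ H := by
      refine (Finset.mem_union.1 (hp a ha)).resolve_right ?_
      exact notMem_queried_of_neverHolds hsn ((hH _ (hpH a ha hne)).resolve_left hamem) _
    refine hT.1 hiH (Finset.mem_union_right _ (Finset.mem_biUnion.2 ⟨p a, hpa, ?_⟩))
    rw [Finset.mem_filter, hpκ a ha, hpA a ha]
    refine ⟨Finset.mem_univ _, ?_⟩
    ext c
    rw [Finset.mem_sdiff, Finset.mem_singleton]
    constructor
    · rintro ⟨hcA, hcK⟩
      by_contra hc
      exact hcK (hAK c hcA hc)
    · rintro rfl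
      exact ⟨hbA, hbK⟩

/-- For no `k`-set `A`, all bits that belong to `A` are queried in the execution on the strings
with the keys `κ`. -/
def LeavesOpen (k : ℕ) (x : Fin m → BStr N) (qset : Fin m → Fin N → Finset (Fin m))
    (κ : Fin s → Fin m) {q : ℕ} (T : MemTree s N q) : Prop :=
  ∀ A : Finset (Fin m), A.card = k →
    ∃ a ∈ A, ∀ p ∈ T.queried fun i => x (κ i), κ p.1 = a → qset a p.2 ≠ A

-- A set that is completely queried forces a surprise, by `subset_of_not_hits` with empty history,
-- and surprises are rare by `card_hits_le`.
open Classical in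
theorem card_not_leavesOpen_le (x : Fin m → BStr N) (qset : Fin m → Fin N → Finset (Fin m))
    {k q : ℕ} (hk : 1 ≤ k) (hm : 0 < m) {T : MemTree s N q} (hT : T.IsStrong (k - 1)) :
    m * (Finset.univ.filter fun κ : Fin s → Fin m => ¬ T.LeavesOpen k x qset κ).card ≤
      q ^ 2 * m ^ s := by
  have key := card_hits_le x (surprises qset) (surprises_congr qset) (card_surprises_le qset) T ∅
    (fun _ => ⟨0, hm⟩) 0 (by simp)
  rw [card_extensions] at key
  simp only [Finset.image_empty, Finset.compl_empty, Finset.card_univ, Fintype.card_fin,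
    zero_add] at key
  refine (Nat.mul_le_mul_left _ (Finset.card_le_card ?_)).trans (key.trans ?_)
  · intro κ hκ
    simp only [Finset.mem_filter, Finset.mem_univ, true_and, mem_extensions,
      Finset.notMem_empty, false_imp_iff, implies_true] at hκ ⊢
    by_contra hhit
    refine hκ fun A hA => ?_
    by_contra! hq
    have := subset_of_not_hits (H := ∅) hk hhit hT (by simp) hA (fun a ha => by
      obtain ⟨p, hp, h⟩ := hq a ha
      exact ⟨p, by simpa using hp, h⟩)
    rw [Finset.image_empty, Finset.image_empty, Finset.subset_empty] at this
    rw [this, Finset.card_empty] at hA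
    omega
  · refine Nat.mul_le_mul_right _ ?_
    -- The sum of 2t over t < q is q(q-1).
    rw [← Finset.mul_sum, mul_comm, Finset.sum_range_id_mul_two, sq]
    exact Nat.mul_le_mul_left _ (Nat.sub_le _ _)

end MemTree

/-! ### Bit assignments and their parities -/

section Assignments

variable {m : ℕ}

open Classical in
/-- The assignments `φ`, of a bit `φ A a` to every set `A` and `a ∈ A`, for which the number of
ones at every set of size `k` satisfies `p`. -/
noncomputable def assignments (k m : ℕ) (p : ℕ → Prop) : Finset (Finset (Fin m) → Fin m → Bool) :=
  Finset.univ.filter fun φ => ∀ A : Finset (Fin m), A.card = k →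
    p (A.filter fun a => φ A a = true).card

theorem mem_assignments {k : ℕ} {p : ℕ → Prop} {φ : Finset (Fin m) → Fin m → Bool} :
    φ ∈ assignments k m p ↔ ∀ A : Finset (Fin m), A.card = k →
      p (A.filter fun a => φ A a = true).card := by
  simp [assignments]

/-- Flip the bit of `c A` at every set `A` of size `k`. -/
def flipAt (k : ℕ) (c : Finset (Fin m) → Fin m) (φ : Finset (Fin m) → Fin m → Bool) :
    Finset (Fin m) → Fin m → Bool :=
  fun A a => if A.card = k ∧ a = c A then !φ A a else φ A a

theorem flipAt_flipAt (k : ℕ) (c : Finset (Fin m) → Fin m) (φ : Finset (Fin m) → Fin m → Bool) :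
    flipAt k c (flipAt k c φ) = φ := by
  funext A a
  simp only [flipAt]
  split_ifs <;> simp

theorem even_card_flipAt {k : ℕ} {c : Finset (Fin m) → Fin m} {φ : Finset (Fin m) → Fin m → Bool}
    {A : Finset (Fin m)} (hA : A.card = k) (hc : c A ∈ A) :
    Even (A.filter fun a => flipAt k c φ A a = true).card ↔
      ¬ Even (A.filter fun a => φ A a = true).card := by
  rw [Finset.card_filter, Finset.card_filter, ← Finset.add_sum_erase A _ hc,
    ← Finset.add_sum_erase A _ hc]
  have : ∑ a ∈ A.erase (c A), (if flipAt k c φ A a = true then 1 else 0) =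
      ∑ a ∈ A.erase (c A), if φ A a = true then 1 else 0 :=
    Finset.sum_congr rfl fun a ha => by simp [flipAt, Finset.ne_of_mem_erase ha]
  rw [this]
  cases h : φ A (c A) <;> simp [flipAt, h, hA, Nat.even_add]

theorem flipAt_mem_odd {k : ℕ} {c : Finset (Fin m) → Fin m}
    (hc : ∀ A : Finset (Fin m), A.card = k → c A ∈ A) {φ : Finset (Fin m) → Fin m → Bool}
    (hφ : φ ∈ assignments k m Even) : flipAt k c φ ∈ assignments k m Odd :=
  mem_assignments.2 fun A hA => by
    rw [← Nat.not_even_iff_odd, even_card_flipAt hA (hc A hA), not_not]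
    exact mem_assignments.1 hφ A hA

theorem flipAt_mem_even {k : ℕ} {c : Finset (Fin m) → Fin m}
    (hc : ∀ A : Finset (Fin m), A.card = k → c A ∈ A) {φ : Finset (Fin m) → Fin m → Bool}
    (hφ : φ ∈ assignments k m Odd) : flipAt k c φ ∈ assignments k m Even :=
  mem_assignments.2 fun A hA => by
    rw [even_card_flipAt hA (hc A hA), Nat.not_even_iff_odd]
    exact mem_assignments.1 hφ A hA

theorem card_assignments_even {k : ℕ} (hk : 1 ≤ k) (hm : 0 < m) :
    (assignments k m Even).card = (assignments k m Odd).card := by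
  have hne : ∀ A : Finset (Fin m), A.card = k → ∃ a, a ∈ A := fun A hA =>
    Finset.card_pos.1 (by omega)
  have : Nonempty (Fin m) := ⟨⟨0, hm⟩⟩
  choose! c hc using hne
  exact Finset.card_bij' (fun φ _ => flipAt k c φ) (fun φ _ => flipAt k c φ)
    (fun φ h => flipAt_mem_odd hc h) (fun φ h => flipAt_mem_even hc h)
    (fun φ _ => flipAt_flipAt k c φ) (fun φ _ => flipAt_flipAt k c φ)

theorem assignments_even_nonempty (k m : ℕ) : (assignments k m Even).Nonempty :=
  ⟨fun _ _ => false, by simp [mem_assignments]⟩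

end Assignments

/-! ### Indistinguishability of even and odd parities -/

namespace MemTree

variable {s N m k q : ℕ}

open Classical in
/-- An execution in which no `k`-set is completely queried cannot tell even from odd parities. -/
theorem card_run_leavesOpen_le (hm : 0 < m) {x : (Finset (Fin m) → Fin m → Bool) → Fin m → BStr N}
    {qset : Fin m → Fin N → Finset (Fin m)}
    (hx : ∀ φ ψ a j, φ (qset a j) a = ψ (qset a j) a → x φ a j = x ψ a j)
    (T : MemTree s N q) (κ : Fin s → Fin m) :
    ((assignments k m Even).filter fun φ =>
      T.LeavesOpen k (x φ) qset κ ∧ T.run (fun i => x φ (κ i)) = true).card ≤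
    ((assignments k m Odd).filter fun φ =>
      T.LeavesOpen k (x φ) qset κ ∧ T.run (fun i => x φ (κ i)) = true).card := by
  let isOpen (Q : Finset (Fin s × Fin N)) (A : Finset (Fin m)) (a : Fin m) : Prop :=
    a ∈ A ∧ ∀ p ∈ Q, κ p.1 = a → qset a p.2 ≠ A
  -- The bit to flip is chosen from the set of queried positions alone. The flip preserves that set,
  -- so it can be undone, which gives injectivity. The default value is not reached for a k-set of
  -- an open execution.
  let c (Q : Finset (Fin s × Fin N)) (A : Finset (Fin m)) : Fin m :=
    if h : ∃ a, isOpen Q A a then h.choose else ⟨0, hm⟩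
  let Q (φ : Finset (Fin m) → Fin m → Bool) := T.queried fun i => x φ (κ i)
  have hc : ∀ φ, T.LeavesOpen k (x φ) qset κ → ∀ A : Finset (Fin m), A.card = k →
      isOpen (Q φ) A (c (Q φ) A) := by
    intro φ hφ A hA
    have h : ∃ a, isOpen (Q φ) A a := hφ A hA
    simp only [c, dif_pos h]
    exact h.choose_spec
  have hrun : ∀ φ, T.LeavesOpen k (x φ) qset κ →
      T.run (fun i => x φ (κ i)) = T.run (fun i => x (flipAt k (c (Q φ)) φ) (κ i)) ∧
        Q φ = Q (flipAt k (c (Q φ)) φ) := by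
    intro φ hφ
    refine run_congr T fun p hp => hx _ _ _ _ ?_
    simp only [flipAt]
    rw [if_neg]
    rintro ⟨hA, ha⟩
    exact (hc φ hφ _ hA).2 p hp ha (by rw [← ha])
  refine Finset.card_le_card_of_injOn (fun φ => flipAt k (c (Q φ)) φ) ?_ ?_
  · intro φ hφ
    obtain ⟨heven, hopen, hacc⟩ := Finset.mem_filter.1 hφ
    refine Finset.mem_filter.2 ⟨flipAt_mem_odd (fun A hA => (hc φ hopen A hA).1) heven, ?_, ?_⟩
    · intro A hA
      obtain ⟨a, ha, h⟩ := hopen A hA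
      exact ⟨a, ha, fun p hp => h p (by
        rw [show T.queried (fun i => x φ (κ i)) = _ from (hrun φ hopen).2]; exact hp)⟩
    · rw [← hacc]
      exact (hrun φ hopen).1.symm
  · intro φ hφ ψ hψ h
    obtain ⟨-, hφ, -⟩ := Finset.mem_filter.1 hφ
    obtain ⟨-, hψ, -⟩ := Finset.mem_filter.1 hψ
    have hQ : Q φ = Q ψ := by
      rw [(hrun φ hφ).2, (hrun ψ hψ).2]
      exact congrArg Q h
    simp only [hQ] at h
    rw [← flipAt_flipAt k (c (Q ψ)) φ, h, flipAt_flipAt]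

open Classical in
/-- On average over the keys, a strong `(k - 1)`-memory algorithm can hardly tell even from odd
parities. -/
theorem sum_card_run_le (hk : 1 ≤ k) (hm : 0 < m)
    {x : (Finset (Fin m) → Fin m → Bool) → Fin m → BStr N}
    {qset : Fin m → Fin N → Finset (Fin m)}
    (hx : ∀ φ ψ a j, φ (qset a j) a = ψ (qset a j) a → x φ a j = x ψ a j)
    {T : MemTree s N q} (hT : T.IsStrong (k - 1)) :
    m * ∑ φ ∈ assignments k m Even,
      (Finset.univ.filter fun κ : Fin s → Fin m => T.run (fun i => x φ (κ i)) = true).card ≤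
    m * ∑ φ ∈ assignments k m Odd,
      (Finset.univ.filter fun κ : Fin s → Fin m => T.run (fun i => x φ (κ i)) = true).card +
    (assignments k m Even).card * (q ^ 2 * m ^ s) := by
  have hswap : ∀ p, ∑ φ ∈ assignments k m p, (Finset.univ.filter fun κ : Fin s → Fin m =>
      T.LeavesOpen k (x φ) qset κ ∧ T.run (fun i => x φ (κ i)) = true).card =
      ∑ κ : Fin s → Fin m, ((assignments k m p).filter fun φ =>
        T.LeavesOpen k (x φ) qset κ ∧ T.run (fun i => x φ (κ i)) = true).card := by
    intro p
    simp only [Finset.card_filter]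
    exact Finset.sum_comm
  calc _ ≤ m * ∑ φ ∈ assignments k m Even, ((Finset.univ.filter fun κ : Fin s → Fin m =>
        T.LeavesOpen k (x φ) qset κ ∧ T.run (fun i => x φ (κ i)) = true).card +
        (Finset.univ.filter fun κ : Fin s → Fin m => ¬ T.LeavesOpen k (x φ) qset κ).card) := by
        refine Nat.mul_le_mul_left _ (Finset.sum_le_sum fun φ _ => ?_)
        refine (Finset.card_le_card fun κ hκ => ?_).trans (Finset.card_union_le _ _)
        simp only [Finset.mem_filter, Finset.mem_univ, true_and, Finset.mem_union] at hκ ⊢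
        tauto
    _ = m * ∑ φ ∈ assignments k m Even, (Finset.univ.filter fun κ : Fin s → Fin m =>
        T.LeavesOpen k (x φ) qset κ ∧ T.run (fun i => x φ (κ i)) = true).card +
        ∑ φ ∈ assignments k m Even, m * (Finset.univ.filter fun κ : Fin s → Fin m =>
          ¬ T.LeavesOpen k (x φ) qset κ).card := by
        rw [Finset.sum_add_distrib, mul_add, ← Finset.mul_sum]
    _ ≤ _ := by
        refine add_le_add (Nat.mul_le_mul_left _ ?_) ?_
        · rw [hswap]
          refine (Finset.sum_le_sum fun κ _ => card_run_leavesOpen_le hm hx T κ).trans ?_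
          rw [← hswap]
          refine Finset.sum_le_sum fun φ _ => Finset.card_le_card fun κ hκ => ?_
          simp only [Finset.mem_filter] at hκ ⊢
          exact ⟨hκ.1, hκ.2.2⟩
        · rw [← smul_eq_mul (assignments k m Even).card]
          exact Finset.sum_le_card_nsmul _ _ _ fun φ _ => card_not_leavesOpen_le _ _ hk hm hT

end MemTree

/-! ### Uniform distributions on indexed strings -/

-- Expanding the product of the image masses gives a sum over key maps, so strings may be replaced
-- by uniform keys even if `x` is not injective.
open Classical in
theorem iidProb_map_uniform {m N : ℕ} [Nonempty (Fin m)] (x : Fin m → BStr N) (s : ℕ)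
    (E : (Fin s → BStr N) → Prop) :
    iidProb ((PMF.uniformOfFintype (Fin m)).map x) s E =
      ((Finset.univ.filter fun κ : Fin s → Fin m => E fun i => x (κ i)).card : ℝ≥0∞) *
        ((m : ℝ≥0∞) ^ s)⁻¹ := by
  have hP : ∀ y, (PMF.uniformOfFintype (Fin m)).map x y =
      ∑ a, if y = x a then (m : ℝ≥0∞)⁻¹ else 0 := by
    intro y
    rw [PMF.map_apply, tsum_fintype]
    simp
  have hprod : ∀ X : Fin s → BStr N, ∏ i, (PMF.uniformOfFintype (Fin m)).map x (X i) =
      ∑ κ : Fin s → Fin m, if X = fun i => x (κ i) then ((m : ℝ≥0∞) ^ s)⁻¹ else 0 := by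
    intro X
    simp only [hP]
    rw [Finset.prod_univ_sum, Fintype.piFinset_univ]
    refine Finset.sum_congr rfl fun κ _ => ?_
    split_ifs with h
    · subst h
      simp [ENNReal.inv_pow]
    · obtain ⟨i, hi⟩ := Function.ne_iff.1 h
      exact Finset.prod_eq_zero (Finset.mem_univ i) (if_neg hi)
  simp only [iidProb, hprod]
  rw [← Finset.sum_filter, Finset.sum_comm, Finset.card_filter, Nat.cast_sum, Finset.sum_mul]
  refine Finset.sum_congr rfl fun κ _ => ?_
  rw [Finset.sum_ite_eq']
  simp

theorem iidProb_map_uniform_eq_zero {m N s : ℕ} [Nonempty (Fin m)] {x : Fin m → BStr N}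
    {E : (Fin s → BStr N) → Prop} (h : ∀ κ : Fin s → Fin m, ¬ E fun i => x (κ i)) :
    iidProb ((PMF.uniformOfFintype (Fin m)).map x) s E = 0 := by
  simp [iidProb_map_uniform, h]

/-- The acceptance probabilities of a strong `(k - 1)`-memory algorithm on the uniform
distributions over the strings of an even assignment are, on average, hardly larger than for an
odd assignment. -/
theorem sum_acceptProb_le {m N k s q : ℕ} [Nonempty (Fin m)] (hk : 1 ≤ k)
    {x : (Finset (Fin m) → Fin m → Bool) → Fin m → BStr N}
    {qset : Fin m → Fin N → Finset (Fin m)}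
    (hx : ∀ φ ψ a j, φ (qset a j) a = ψ (qset a j) a → x φ a j = x ψ a j)
    (𝒜 : StrongMemAlg (k - 1) s N q) :
    ∑ φ ∈ assignments k m Even, acceptProb 𝒜 ((PMF.uniformOfFintype (Fin m)).map (x φ)) ≤
    ∑ φ ∈ assignments k m Odd, acceptProb 𝒜 ((PMF.uniformOfFintype (Fin m)).map (x φ)) +
      (assignments k m Even).card * ((q : ℝ≥0∞) ^ 2 / m) := by
  have hm : 0 < m := Fin.pos_iff_nonempty.2 inferInstance
  have hm0 : (m : ℝ≥0∞) ≠ 0 := by exact_mod_cast hm.ne'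
  have hmt : (m : ℝ≥0∞) ≠ ⊤ := ENNReal.natCast_ne_top m
  have hT : ∀ T : {T : MemTree s N q // T.IsStrong (k - 1)},
      ∑ φ ∈ assignments k m Even,
        iidProb ((PMF.uniformOfFintype (Fin m)).map (x φ)) s (fun X => T.1.run X = true) ≤
      ∑ φ ∈ assignments k m Odd,
        iidProb ((PMF.uniformOfFintype (Fin m)).map (x φ)) s (fun X => T.1.run X = true) +
      (assignments k m Even).card * ((q : ℝ≥0∞) ^ 2 / m) := by
    intro T
    simp only [iidProb_map_uniform]
    have key := MemTree.sum_card_run_le hk hm hx T.2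
    rw [← Finset.sum_mul, ← Finset.sum_mul]
    have key' := (Nat.cast_le (α := ℝ≥0∞)).2 key
    simp only [Nat.cast_mul, Nat.cast_add, Nat.cast_sum, Nat.cast_pow] at key'
    rw [← ENNReal.mul_le_mul_iff_right hm0 hmt,
      ← ENNReal.mul_le_mul_iff_left (c := (m : ℝ≥0∞) ^ s)
        (pow_ne_zero _ hm0) (ENNReal.pow_ne_top hmt)]
    have hms : ((m : ℝ≥0∞) ^ s)⁻¹ * (m : ℝ≥0∞) ^ s = 1 :=
      ENNReal.inv_mul_cancel (pow_ne_zero _ hm0) (ENNReal.pow_ne_top hmt)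
    have hmm : (q : ℝ≥0∞) ^ 2 / m * m = q ^ 2 := ENNReal.div_mul_cancel hm0 hmt
    refine (le_of_eq ?_).trans (key'.trans (le_of_eq ?_))
    · rw [mul_assoc, mul_assoc, hms, mul_one]
      congr!
    · rw [mul_add, add_mul, mul_assoc, mul_assoc, hms, mul_one]
      congr 1
      · congr!
      · rw [mul_comm (m : ℝ≥0∞), mul_assoc ((assignments k m Even).card : ℝ≥0∞), hmm, mul_assoc]
  have hsum : ∀ p, ∑ φ ∈ assignments k m p,
      acceptProb 𝒜 ((PMF.uniformOfFintype (Fin m)).map (x φ)) =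
      ∑' T, 𝒜 T * ∑ φ ∈ assignments k m p,
        iidProb ((PMF.uniformOfFintype (Fin m)).map (x φ)) s (fun X => T.1.run X = true) := by
    intro p
    simp only [acceptProb, Finset.mul_sum]
    exact (Summable.tsum_finsetSum fun _ _ => ENNReal.summable).symm
  rw [hsum, hsum]
  refine (ENNReal.tsum_le_tsum fun T => mul_le_mul_right (hT T) _).trans ?_
  simp only [mul_add]
  rw [ENNReal.tsum_add, ENNReal.tsum_mul_right, PMF.tsum_coe, one_mul]

theorem sum_pmf_map_mul {α β : Type} [Fintype α] [Fintype β] (p : PMF α) (f : α → β)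
    (g : β → ℝ≥0∞) : ∑ y, p.map f y * g y = ∑ x, p x * g (f x) := by
  classical
  simp only [PMF.map_apply, tsum_fintype, Finset.sum_mul, ite_mul, zero_mul]
  rw [Finset.sum_comm]
  refine Finset.sum_congr rfl fun x _ => ?_
  rw [Finset.sum_ite_eq' Finset.univ (f x) fun y => p x * g y]
  simp

/-! ### The distribution of an assignment -/

section ParStr

variable {k m : ℕ}

/-- The set to which bit `j` of a string with key `a` belongs, `∅` if `j` is in the key part. -/
def bitSet (enc : ∀ a : Fin m, CoSet k m a ≃ Fin (parLen k m)) (a : Fin m)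
    (j : Fin (2 * parLen k m)) : Finset (Fin m) :=
  if parLen k m ≤ j then insert a ((enc a).symm ⟨j - parLen k m, by omega⟩).1 else ∅

/-- The string with the key `a` and the data bits of the assignment `φ`. -/
def parStr (C : Fin m → BStr (parLen k m)) (enc : ∀ a : Fin m, CoSet k m a ≃ Fin (parLen k m))
    (φ : Finset (Fin m) → Fin m → Bool) (a : Fin m) : BStr (2 * parLen k m) :=
  fun j => if h : (j : ℕ) < parLen k m then C a ⟨j, h⟩ else φ (bitSet enc a j) a

variable {C : Fin m → BStr (parLen k m)} {enc : ∀ a : Fin m, CoSet k m a ≃ Fin (parLen k m)}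

theorem parStr_congr (φ ψ : Finset (Fin m) → Fin m → Bool) (a : Fin m)
    (j : Fin (2 * parLen k m)) (h : φ (bitSet enc a j) a = ψ (bitSet enc a j) a) :
    parStr C enc φ a j = parStr C enc ψ a j := by
  simp only [parStr, h]

theorem keyPart_parStr (φ : Finset (Fin m) → Fin m → Bool) (a : Fin m) :
    keyPart (parStr C enc φ a) = C a := by
  funext j
  simp [keyPart, parStr]

theorem dataPart_parStr (φ : Finset (Fin m) → Fin m → Bool) (a : Fin m) (j : Fin (parLen k m)) :
    dataPart (parStr C enc φ a) j = φ (insert a ((enc a).symm j).1) a := by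
  simp [dataPart, parStr, bitSet]

theorem hasKey_parStr (φ : Finset (Fin m) → Fin m → Bool) (a : Fin m) :
    HasKey C (parStr C enc φ a) a := fun j _ => by rw [keyPart_parStr]

theorem HasKey.unique (hC : IsSystematicCode C) {x : BStr (2 * parLen k m)} {a b : Fin m}
    (ha : HasKey C x a) (hb : HasKey C x b) : a = b :=
  hC.prefixInj a b fun j hj => (ha j hj).symm.trans (hb j hj)

theorem parStr_injective (hC : IsSystematicCode C) (φ : Finset (Fin m) → Fin m → Bool) :
    Function.Injective (parStr C enc φ) := fun a b h =>
  (hasKey_parStr φ a).unique hC (h ▸ hasKey_parStr φ b)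

theorem insert_coSet (a : Fin k ↪o Fin m) (i : Fin k) :
    insert (a i) (coSet a i).1 = Finset.univ.map a.toEmbedding :=
  Finset.insert_erase (by simp)

theorem dataPart_parStr_coSet (φ : Finset (Fin m) → Fin m → Bool) (a : Fin k ↪o Fin m)
    (i : Fin k) : dataPart (parStr C enc φ (a i)) (enc (a i) (coSet a i)) =
      φ (Finset.univ.map a.toEmbedding) (a i) := by
  rw [dataPart_parStr, Equiv.symm_apply_apply, insert_coSet]

theorem card_filter_map (φ : Finset (Fin m) → Fin m → Bool) (a : Fin k ↪o Fin m) :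
    (Finset.univ.filter fun i : Fin k => φ (Finset.univ.map a.toEmbedding) (a i) = true).card =
      ((Finset.univ.map a.toEmbedding).filter fun b =>
        φ (Finset.univ.map a.toEmbedding) b = true).card := by
  rw [Finset.filter_map, Finset.card_map]
  rfl

theorem map_parStr_mem_par [Nonempty (Fin m)] (hC : IsSystematicCode C)
    {φ : Finset (Fin m) → Fin m → Bool} (hφ : φ ∈ assignments k m Even) :
    (PMF.uniformOfFintype (Fin m)).map (parStr C enc φ) ∈ Par C enc := by
  refine ⟨fun x hx => ?_, fun a => ?_⟩
  · obtain ⟨a, -, rfl⟩ := (PMF.mem_support_map_iff _ _ _).1 hx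
    exact ⟨a, hasKey_parStr φ a, keyPart_parStr φ a⟩
  · refine iidProb_map_uniform_eq_zero fun κ => ?_
    rintro ⟨hkey, hodd⟩
    have hκ : ∀ i, κ i = a i := fun i => (hasKey_parStr φ _).unique hC (hkey i)
    simp only [hκ, dataPart_parStr_coSet] at hodd
    rw [card_filter_map] at hodd
    exact Nat.not_even_iff_odd.2 hodd (mem_assignments.1 hφ _ (by simp))

end ParStr

/-! ### Odd assignments are far from the property -/

/-- If every `k`-set is charged to one of its elements, then the charges, truncated at a third of
the largest possible charge, still exceed a third of the number of sets. -/
theorem lt_sum_min_card {k m n : ℕ} (hk : 2 ≤ k) (hm : k ≤ m) (hn : n = (m - 1).choose (k - 1))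
    (inc : Fin m → Finset (Finset (Fin m))) (hinc : ∀ a, ∀ A ∈ inc a, a ∈ A ∧ A.card = k)
    (hcover : ∀ A : Finset (Fin m), A.card = k → ∃ a, A ∈ inc a)
    (hle : ∀ a, (inc a).card ≤ n)
    (hfull : ∀ a, (inc a).card = n → ∀ A : Finset (Fin m), A.card = k → a ∈ A → A ∈ inc a) :
    n * m < 3 * k * ∑ a, min ((n + 2) / 3) (inc a).card := by
  by_contra! hcon
  have hchoose : n * m = k * m.choose k := by
    obtain ⟨m', rfl⟩ : ∃ m', m = m' + 1 := ⟨m - 1, by omega⟩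
    obtain ⟨k', rfl⟩ : ∃ k', k = k' + 1 := ⟨k - 1, by omega⟩
    have := Nat.add_one_mul_choose_eq m' k'
    rw [hn, Nat.add_sub_cancel, Nat.add_sub_cancel]
    linarith
  have hpos : 0 < m.choose k := Nat.choose_pos hm
  have hdouble : ∑ a, (inc a).card = ∑ A ∈ Finset.powersetCard k Finset.univ,
      (Finset.univ.filter fun a => A ∈ inc a).card := by
    simp only [Finset.card_filter]
    rw [Finset.sum_comm]
    refine Finset.sum_congr rfl fun a _ => ?_
    rw [← Finset.card_filter]
    congr 1
    ext A
    simp only [Finset.mem_filter, Finset.mem_powersetCard_univ]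
    exact ⟨fun h => ⟨(hinc a A h).2, h⟩, fun h => h.2⟩
  have hone : ∀ A ∈ Finset.powersetCard k (Finset.univ : Finset (Fin m)),
      1 ≤ (Finset.univ.filter fun a => A ∈ inc a).card := by
    intro A hA
    obtain ⟨a, ha⟩ := hcover A (Finset.mem_powersetCard_univ.1 hA)
    exact Finset.card_pos.2 ⟨a, by simpa using ha⟩
  have hcount : ∑ A ∈ Finset.powersetCard k (Finset.univ : Finset (Fin m)), 1 = m.choose k := by
    rw [← Finset.card_eq_sum_ones, Finset.card_powersetCard, Finset.card_univ, Fintype.card_fin]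
  have h1 : m.choose k ≤ ∑ a, (inc a).card := by
    rw [hdouble, ← hcount]
    exact Finset.sum_le_sum hone
  have hmin : ∀ a ∈ (Finset.univ : Finset (Fin m)),
      (inc a).card ≤ 3 * min ((n + 2) / 3) (inc a).card := by
    intro a _
    have := hle a
    omega
  have h2 : ∑ a, (inc a).card ≤ ∑ a, 3 * min ((n + 2) / 3) (inc a).card :=
    Finset.sum_le_sum hmin
  have h3 : ∑ a, 3 * min ((n + 2) / 3) (inc a).card ≤ m.choose k := by
    rw [← Finset.mul_sum]
    rw [hchoose] at hcon
    exact Nat.le_of_mul_le_mul_left (by linarith) (by omega : 0 < k)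
  -- All the inequalities are squeezed to equalities: each nonempty charge is full with n divisible
  -- by 3, and each k-set is charged exactly once.
  have hext := (Finset.sum_eq_sum_iff_of_le hmin).1 (by omega)
  have huniq := (Finset.sum_eq_sum_iff_of_le hone).1 (by omega)
  have hzero : ∀ a, (inc a).card ≠ 0 → (inc a).card = n ∧ n ≠ 1 := by
    intro a ha
    have := hext a (Finset.mem_univ a)
    have := hle a
    omega
  -- For k = m, n = 1 is not divisible by 3. For k < m, two charged elements lie in a common k-set,
  -- which is then charged twice; with at most one charged element, some k-set avoids it and is not
  -- charged.
  rcases hm.eq_or_lt with rfl | hlt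
  · rw [Nat.choose_self] at hn
    have : ∑ a, (inc a).card = 0 := Finset.sum_eq_zero fun a _ => by
      by_contra h
      exact (hzero a h).2 hn
    omega
  set B : Finset (Fin m) := Finset.univ.filter fun a => (inc a).card ≠ 0 with hB
  rcases Nat.lt_or_ge 1 B.card with hBc | hBc
  · obtain ⟨a, ha, b, hb, hab⟩ := Finset.one_lt_card.1 hBc
    obtain ⟨A, habA, -, hA⟩ := Finset.exists_subsuperset_card_eq
      (Finset.subset_univ ({a, b} : Finset (Fin m))) (Finset.card_le_two.trans hk)
      (by simpa using hm)
    have hmem : ∀ c ∈ B, c ∈ A → A ∈ inc c := fun c hc hcA =>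
      hfull c (hzero c (Finset.mem_filter.1 hc).2).1 A hA hcA
    have := huniq A (Finset.mem_powersetCard_univ.2 hA)
    refine hab (Finset.card_le_one.1 this.ge a ?_ b ?_)
    · simpa using hmem a ha (habA (by simp))
    · simpa using hmem b hb (habA (by simp))
  · have hcompl : k ≤ Bᶜ.card := by
      rw [Finset.card_compl, Fintype.card_fin]
      omega
    obtain ⟨A, hAB, hA⟩ := Finset.exists_subset_card_eq hcompl
    obtain ⟨a, ha⟩ := hcover A hA
    refine Finset.mem_compl.1 (hAB (hinc a A ha).1) ?_
    rw [hB, Finset.mem_filter]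
    exact ⟨Finset.mem_univ a, Finset.card_ne_zero_of_mem ha⟩

section Far

variable {k m : ℕ} {C : Fin m → BStr (parLen k m)}
  {enc : ∀ a : Fin m, CoSet k m a ≃ Fin (parLen k m)}

open Classical in
/-- The data bits in which all the strings of `Q` with the key `a` differ from `x`. -/
noncomputable def conflicts (C : Fin m → BStr (parLen k m)) (Q : PMF (BStr (2 * parLen k m)))
    (x : BStr (2 * parLen k m)) (a : Fin m) : Finset (Fin (parLen k m)) :=
  Finset.univ.filter fun j => ∀ y ∈ Q.support, HasKey C y a → dataPart x j ≠ dataPart y j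

/-- Otherwise `Q` has, for each key, a string that agrees with the odd assignment at this set; these
strings form an odd tuple of positive probability. -/
theorem exists_mem_conflicts {φ : Finset (Fin m) → Fin m → Bool}
    (hφ : φ ∈ assignments k m Odd) {Q : PMF (BStr (2 * parLen k m))} (hQ : Q ∈ Par C enc)
    (a : Fin k ↪o Fin m) :
    ∃ i, enc (a i) (coSet a i) ∈ conflicts C Q (parStr C enc φ (a i)) (a i) := by
  by_contra! hno
  simp only [conflicts, Finset.mem_filter, Finset.mem_univ, true_and, not_forall,
    not_not, exists_prop] at hno
  choose y hyQ hykey hydata using hno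
  have h0 := hQ.2 a
  rw [ParityValidAt, iidProb, Finset.sum_eq_zero_iff] at h0
  have := h0 y (Finset.mem_univ y)
  rw [if_pos, Finset.prod_eq_zero_iff] at this
  · obtain ⟨i, -, hi⟩ := this
    exact (PMF.mem_support_iff _ _).1 (hyQ i) hi
  · refine ⟨hykey, ?_⟩
    simp only [← hydata, dataPart_parStr_coSet]
    rw [card_filter_map]
    exact mem_assignments.1 hφ _ (by simp)

theorem lt_sum_min_conflicts (hk : 2 ≤ k) (hm : k ≤ m) {φ : Finset (Fin m) → Fin m → Bool}
    (hφ : φ ∈ assignments k m Odd) {Q : PMF (BStr (2 * parLen k m))} (hQ : Q ∈ Par C enc) :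
    parLen k m * m < 3 * k * ∑ a, min ((parLen k m + 2) / 3)
      (conflicts C Q (parStr C enc φ a) a).card := by
  set D := fun a => conflicts C Q (parStr C enc φ a) a with hD
  let f (a : Fin m) (j : Fin (parLen k m)) : Finset (Fin m) := insert a ((enc a).symm j).1
  have hcard : ∀ a, ((D a).image (f a)).card = (D a).card := by
    intro a
    refine Finset.card_image_of_injective _ fun j j' h => ?_
    refine (enc a).symm.injective (Subtype.ext ?_)
    have := congrArg (fun A => Finset.erase A a) h
    simpa [f, Finset.erase_insert ((enc a).symm j).2.1,
      Finset.erase_insert ((enc a).symm j').2.1] using this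
  have := lt_sum_min_card hk hm rfl (fun a => (D a).image (f a)) ?_ ?_ ?_ ?_
  · simpa only [hcard] using this
  · intro a A hA
    obtain ⟨j, -, rfl⟩ := Finset.mem_image.1 hA
    refine ⟨Finset.mem_insert_self _ _, ?_⟩
    rw [Finset.card_insert_of_notMem ((enc a).symm j).2.1, ((enc a).symm j).2.2]
    omega
  · intro A hA
    obtain ⟨i, hi⟩ := exists_mem_conflicts hφ hQ (A.orderEmbOfFin hA)
    refine ⟨_, Finset.mem_image.2 ⟨_, hi, ?_⟩⟩
    simp only [f]
    rw [Equiv.symm_apply_apply, insert_coSet]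
    exact Finset.map_orderEmbOfFin_univ A hA
  · intro a
    simp only [hcard]
    exact (Finset.card_le_univ _).trans (by simp)
  · intro a ha A hA haA
    simp only [hcard] at ha
    have hD' : D a = Finset.univ := Finset.eq_univ_of_card _ (by simpa using ha)
    refine Finset.mem_image.2 ⟨enc a ⟨A.erase a, Finset.notMem_erase _ _, ?_⟩, ?_, ?_⟩
    · rw [Finset.card_erase_of_mem haA, hA]
    · rw [hD']; exact Finset.mem_univ _
    · simp [f, Finset.insert_erase haA]

theorem hammingDist_keyPart_le {n : ℕ} (x y : BStr (2 * n)) :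
    hammingDist (keyPart x) (keyPart y) ≤ hammingDist x y := by
  refine Finset.card_le_card_of_injOn (fun j : Fin n => (⟨j, by omega⟩ : Fin (2 * n))) ?_ ?_
  · intro j hj
    have := (Finset.mem_filter.1 hj).2
    simpa [keyPart] using this
  · intro i _ j _ h
    simpa [Fin.ext_iff] using h

theorem hammingDist_dataPart_le {n : ℕ} (x y : BStr (2 * n)) :
    hammingDist (dataPart x) (dataPart y) ≤ hammingDist x y := by
  refine Finset.card_le_card_of_injOn (fun j : Fin n => (⟨n + j, by omega⟩ : Fin (2 * n))) ?_ ?_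
  · intro j hj
    have := (Finset.mem_filter.1 hj).2
    simpa [dataPart] using this
  · intro i _ j _ h
    simpa [Fin.ext_iff] using h

theorem IsSystematicCode.le_hammingDist (hC : IsSystematicCode C) {a b : Fin m} (hab : a ≠ b) :
    (parLen k m + 2) / 3 ≤ hammingDist (C a) (C b) := by
  have h := hC.minDist a b hab
  have h' : parLen k m ≤ 3 * hammingDist (C a) (C b) := by
    rcases Nat.eq_zero_or_pos (parLen k m) with h0 | h0
    · omega
    · have hn : (parLen k m : ℝ≥0∞) ≠ 0 := by exact_mod_cast h0.ne'
      rw [normHamming, ENNReal.le_div_iff_mul_le (Or.inl hn) (Or.inl (ENNReal.natCast_ne_top _)),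
        ← ENNReal.mul_div_right_comm, one_mul, ENNReal.div_le_iff' (by simp) (by simp)] at h
      exact_mod_cast h
  omega

-- If `y` has the same key, every conflict is a differing data bit; if not, the code distance
-- already gives ⌈n/3⌉ differing key bits.
open Classical in
theorem min_conflicts_le_hammingDist (hC : IsSystematicCode C)
    (φ : Finset (Fin m) → Fin m → Bool) {Q : PMF (BStr (2 * parLen k m))} (hQ : Q ∈ Par C enc)
    (a : Fin m) {y : BStr (2 * parLen k m)} (hy : y ∈ Q.support) :
    min ((parLen k m + 2) / 3) (conflicts C Q (parStr C enc φ a) a).card ≤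
      hammingDist (parStr C enc φ a) y := by
  obtain ⟨b, hb, hbC⟩ := hQ.1 y hy
  by_cases hab : a = b
  · subst hab
    refine (min_le_right _ _).trans ((Finset.card_le_card fun j hj => ?_).trans
      (hammingDist_dataPart_le _ _))
    exact Finset.mem_filter.2 ⟨Finset.mem_univ j, (Finset.mem_filter.1 hj).2 y hy hb⟩
  · refine (min_le_left _ _).trans ((hC.le_hammingDist hab).trans ?_)
    have := hammingDist_keyPart_le (parStr C enc φ a) y
    rwa [keyPart_parStr, hbC] at this

theorem inv_mul_natCast_div {W n m : ℕ} (hn : (0 : ℝ) < n) (hm : (0 : ℝ) < m) :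
    (m : ℝ≥0∞)⁻¹ * (W / ((2 * n : ℕ) : ℝ≥0∞)) = ENNReal.ofReal (W / (2 * n * m)) := by
  rw [ENNReal.ofReal_div_of_pos (by positivity), ENNReal.ofReal_mul (by positivity),
    ENNReal.ofReal_mul (by positivity), ENNReal.ofReal_natCast, ENNReal.ofReal_natCast,
    ENNReal.ofReal_natCast, ENNReal.ofReal_ofNat, div_eq_mul_inv, div_eq_mul_inv,
    ENNReal.mul_inv (Or.inr (by simp)) (Or.inl (by finiteness))]
  push_cast
  ring

theorem isFar_map_parStr [Nonempty (Fin m)] (hk : 2 ≤ k) (hm : k ≤ m) (hC : IsSystematicCode C)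
    {φ : Finset (Fin m) → Fin m → Bool} (hφ : φ ∈ assignments k m Odd) :
    IsFar (1 / (6 * (k : ℝ))) ((PMF.uniformOfFintype (Fin m)).map (parStr C enc φ))
      (Par C enc) := by
  have hn0 : 0 < parLen k m := Nat.choose_pos (by omega)
  have hnR : (0 : ℝ) < parLen k m := by exact_mod_cast hn0
  have hmR : (0 : ℝ) < m := by exact_mod_cast (by omega : 0 < m)
  have hkR : (0 : ℝ) < k := by exact_mod_cast (by omega : 0 < k)
  -- The infimum over `Q` could lose strictness; integrality of the bit counts supplies a gap, the
  -- +1, that does not depend on `Q`.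
  refine lt_of_lt_of_le (b := ENNReal.ofReal ((parLen k m * m + 1) /
    (6 * k * parLen k m * m))) ?_ ?_
  · rw [ENNReal.ofReal_lt_ofReal_iff (by positivity), div_lt_div_iff₀ (by positivity)
      (by positivity)]
    nlinarith
  refine le_iInf₂ fun Q hQ => le_iInf₂ fun T hT => ?_
  set w := fun a => min ((parLen k m + 2) / 3) (conflicts C Q (parStr C enc φ a) a).card with hw
  have hlt : parLen k m * m < 3 * k * ∑ a, w a := lt_sum_min_conflicts hk hm hφ hQ
  -- This lower bound on the cost depends only on the source string, so its expectation is the same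
  -- for every transfer.
  let g (x : BStr (2 * parLen k m)) : ℝ≥0∞ :=
    (w (Function.invFun (parStr C enc φ) x) : ℝ≥0∞) / ((2 * parLen k m : ℕ) : ℝ≥0∞)
  have hg : ∀ a, g (parStr C enc φ a) = (w a : ℝ≥0∞) / ((2 * parLen k m : ℕ) : ℝ≥0∞) := fun a => by
    simp only [g, Function.leftInverse_invFun (parStr_injective hC φ) a]
  have hle : ∑ z, T z * g z.1 ≤
      ∑ z : BStr (2 * parLen k m) × BStr (2 * parLen k m), T z * normHamming z.1 z.2 := by
    refine Finset.sum_le_sum fun z _ => ?_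
    by_cases hz : T z = 0
    · simp [hz]
    have hzT : z ∈ T.support := (PMF.mem_support_iff _ _).2 hz
    have h1 : z.1 ∈ ((PMF.uniformOfFintype (Fin m)).map (parStr C enc φ)).support := by
      rw [← hT.1]
      exact (PMF.mem_support_map_iff _ _ _).2 ⟨z, hzT, rfl⟩
    have h2 : z.2 ∈ Q.support := by
      rw [← hT.2]
      exact (PMF.mem_support_map_iff _ _ _).2 ⟨z, hzT, rfl⟩
    obtain ⟨a, -, ha⟩ := (PMF.mem_support_map_iff _ _ _).1 h1
    refine mul_le_mul_right ?_ _
    rw [← ha, hg, normHamming]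
    refine ENNReal.div_le_div_right ?_ _
    exact_mod_cast min_conflicts_le_hammingDist hC φ hQ a h2
  refine le_trans ?_ hle
  rw [← sum_pmf_map_mul T Prod.fst g, hT.1, sum_pmf_map_mul]
  have hcost : ∑ a, PMF.uniformOfFintype (Fin m) a * g (parStr C enc φ a) =
      ENNReal.ofReal ((∑ a, w a : ℕ) / (2 * parLen k m * m)) := by
    simp only [hg, PMF.uniformOfFintype_apply, Fintype.card_fin]
    rw [← Finset.mul_sum]
    simp only [div_eq_mul_inv]
    rw [← Finset.sum_mul, ← Nat.cast_sum, ← div_eq_mul_inv, inv_mul_natCast_div hnR hmR,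
      div_eq_mul_inv]
  rw [hcost]
  refine ENNReal.ofReal_le_ofReal ?_
  rw [div_le_div_iff₀ (by positivity) (by positivity)]
  have hlt' : (parLen k m : ℝ) * m + 1 ≤ 3 * k * (∑ a, w a : ℕ) := by exact_mod_cast hlt
  calc (parLen k m * m + 1) * (2 * parLen k m * m) ≤
      (3 * k * (∑ a, w a : ℕ)) * (2 * (parLen k m : ℝ) * m) :=
        mul_le_mul_of_nonneg_right hlt' (by positivity)
    _ = _ := by ring

end Far

/-! ### The lower bound -/

theorem mainTheorem5 (k m : ℕ) (hk : 2 ≤ k) (hm : k ≤ m)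
    (C : Fin m → BStr (parLen k m)) (hC : IsSystematicCode C)
    (enc : ∀ a : Fin m, CoSet k m a ≃ Fin (parLen k m))
    (s q : ℕ) (𝒜 : StrongMemAlg (k - 1) s (2 * parLen k m) q)
    (htest : IsTest (1 / (6 * (k : ℝ))) 𝒜 (Par C enc)) :
    1 / 2 * √(m : ℝ) ≤ (q : ℝ) := by
  by_contra! hq
  have hm0 : 0 < m := by omega
  have : Nonempty (Fin m) := ⟨⟨0, hm0⟩⟩
  have hqm : 4 * q ^ 2 ≤ m := by
    have h := Real.sq_sqrt (Nat.cast_nonneg (α := ℝ) m)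
    have : 4 * (q : ℝ) ^ 2 ≤ m := by nlinarith [Nat.cast_nonneg (α := ℝ) q]
    exact_mod_cast this
  have key := sum_acceptProb_le (k := k) (by omega) (parStr_congr (C := C) (enc := enc)) 𝒜
  have hyes : (assignments k m Even).card * (2 / 3 : ℝ≥0∞) ≤ ∑ φ ∈ assignments k m Even,
      acceptProb 𝒜 ((PMF.uniformOfFintype (Fin m)).map (parStr C enc φ)) := by
    rw [← nsmul_eq_mul]
    exact Finset.card_nsmul_le_sum _ _ _ fun φ hφ =>
      (htest.1 _ (map_parStr_mem_par hC hφ)).le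
  have hno : ∑ φ ∈ assignments k m Odd,
      acceptProb 𝒜 ((PMF.uniformOfFintype (Fin m)).map (parStr C enc φ)) ≤
      (assignments k m Even).card * (1 / 3 : ℝ≥0∞) := by
    rw [card_assignments_even (by omega) hm0, ← nsmul_eq_mul]
    exact Finset.sum_le_card_nsmul _ _ _ fun φ hφ =>
      (htest.2 _ (isFar_map_parStr hk hm hC hφ)).le
  have h := hyes.trans (key.trans (add_le_add_left hno _))
  rw [← mul_add, ENNReal.mul_le_mul_iff_right
    (by exact_mod_cast (assignments_even_nonempty k m).card_pos.ne')
    (ENNReal.natCast_ne_top _)] at h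
  -- A test needs an average advantage of at least 2/3 - 1/3 = 1/3, which exceeds 1/4.
  have hfrac : (q : ℝ≥0∞) ^ 2 / m ≤ 1 / 4 := by
    rw [ENNReal.div_le_iff (by exact_mod_cast hm0.ne') (ENNReal.natCast_ne_top m), mul_comm,
      mul_one_div,
      ENNReal.le_div_iff_mul_le (by simp) (by simp), mul_comm]
    exact_mod_cast hqm
  have h' := h.trans (add_le_add_right hfrac _)
  have h'' := ENNReal.toReal_mono (by finiteness) h'
  rw [ENNReal.toReal_add (by finiteness) (by finiteness)] at h''
  norm_num at h''
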